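/- Conventions. All logarithms are to base $2$. Let $n,m,d$ be nonnegative integers, $N=\{0,1\}^n$, $M=\{0,1\}^m$, $D=\{0,1\}^d$, and let $k,\varepsilon$ be real numbers. For $f:N\to M$ let $F$ be the $M\times N$ matrix with $F_{y,x}=1$ if $f(x)=y$ and $F_{y,x}=0$ otherwise. For a family $\mathrm{Ext}=\{f_s\}_{s\in D}$ of functions $f_s:N\to M$, let $F_s$ be the matrix of $f_s$. The family $\mathrm{Ext}$ is a $(k,\varepsilon)$-extractor if for every probability distribution $P$ on $N$ with $H_{\min}(N)_P:=-\log\max_x P(x)\ge k$, $$\Big\|\frac1{2^d}\sum_{s\in D}F_sP-\upsilon_M\Big\|_{\ell_1}\le\varepsilon ,$$ where $\upsilon_M$ is the uniform distribution on $M$. A classical-quantum state on $Q\otimes N$, with $Q$ a finite-dimensional complex inner-product space, is a positive semidefinite operator of trace $1$ of the form $\rho_{QN}=\sum_{x\in N}\rho_x\otimes|x\rangle\langle x|$ with all $\rho_x\ge0$; put $\rho_Q=\sum_x\rho_x$ and $$H_{\min}(N|Q)_\rho:=-\log\inf_{\sigma}\big\|(\sigma^{-1/2}\otimes 1_N)\,\rho_{QN}\,(\sigma^{-1/2}\otimes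 1_N)\big\|_\infty ,$$ where $\sigma$ ranges over the states (positive semidefinite operators of trace $1$) on $Q$ whose support contains the support of $\rho_Q$, the inverse is the generalized inverse, and $\|\cdot\|_\infty$ is the operator norm. The family $\mathrm{Ext}$ is a quantum-proof $(k,\varepsilon)$-extractor if for every finite-dimensional $Q$ and every classical-quantum state $\rho_{QN}$ with $H_{\min}(N|Q)_\rho\ge k$, $$\Big\|\frac1{2^d}\sum_{s\in D}(\mathrm{id}_Q\otimes F_s)(\rho_{QN})-\rho_Q\otimes\upsilon_M\Big\|_1\le\varepsilon ,$$ where $\|A\|_1=\mathrm{Tr}\sqrt{A^*A}$ is the trace norm, $(\mathrm{id}_Q\otimes F_s)(\rho_{QN})=\sum_x\rho_x\otimes|f_s(x)\rangle\langle f_s(x)|$, and $\upsilon_M$ is identified with the maximally mixed state on $M$. Statement. Every $(k,\varepsilon)$-extractor $\{f_s:\{0,1\}^n\to\{0,1\}^m\}_{s\in\{0,1\}^d}$ is a quantum-proof $\big(k+1,\,6\sqrt{2^m}\,\varepsilon\big)$-extractor. -/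

import Mathlib

open scoped Matrix Kronecker ComplexOrder

/-- Bit strings of length `n`, a system of dimension `2 ^ n`. -/
abbrev BitString (n : ℕ) : Type := Fin n → Bool

namespace QExt

noncomputable section

/-! ## Classical extractors -/

/-- `P` is a probability distribution on the finite set `N`. -/
def IsProbDist {N : Type*} [Fintype N] (P : N → ℝ) : Prop :=
  (∀ x, 0 ≤ P x) ∧ ∑ x, P x = 1

/-- The min-entropy `-log₂ max_x P(x)` of a probability distribution. -/
def minEntropy {N : Type*} (P : N → ℝ) : ℝ :=
  -Real.logb 2 (⨆ x, P x)

/-- The `M × N` matrix of a function `f : N → M`: the entry `(y, x)` is one if `f x = y` and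
zero otherwise. -/
def funMatrix (R : Type*) [Zero R] [One R] {N M : Type*} [DecidableEq M] (f : N → M) :
    Matrix M N R :=
  Matrix.of fun y x => if f x = y then 1 else 0

/-- The family `f` of functions `N → M`, indexed by the seeds in `D`, is a (weak)
`(k, ε)`-extractor: on every input distribution of min-entropy at least `k`, the output under a
uniform seed is `ε`-close in `ℓ₁`-norm to the uniform distribution. -/
def IsExtractor {D N M : Type*} [Fintype D] [Fintype N] [Fintype M] [DecidableEq M]
    (f : D → N → M) (k ε : ℝ) : Prop :=
  ∀ P : N → ℝ, IsProbDist P → k ≤ minEntropy P →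
    ∑ y, |((1 / (Fintype.card D : ℝ)) • ∑ s, funMatrix ℝ (f s) *ᵥ P) y
      - 1 / (Fintype.card M : ℝ)| ≤ ε

/-! ## Quantum systems -/

/-- The trace norm `Tr √(A* A)`. -/
def traceNorm {ι : Type*} [Fintype ι] [DecidableEq ι] (A : Matrix ι ι ℂ) : ℝ :=
  (cfc Real.sqrt (Aᴴ * A)).trace.re

open scoped Matrix.Norms.L2Operator in
/-- The operator norm (largest singular value). -/
def opNorm {ι : Type*} [Fintype ι] [DecidableEq ι] (A : Matrix ι ι ℂ) : ℝ := ‖A‖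

/-- States of a system: positive semidefinite matrices of trace one. -/
def IsState {ι : Type*} [Fintype ι] (ρ : Matrix ι ι ℂ) : Prop :=
  ρ.PosSemidef ∧ ρ.trace = 1

/-- Classical-quantum states: states of the form `∑ₓ ρₓ ⊗ |x⟩⟨x|` with `ρₓ` positive
semidefinite. -/
def IsCQState {Q N : Type*} [Fintype Q] [Fintype N] [DecidableEq N]
    (ρ : Matrix (Q × N) (Q × N) ℂ) : Prop :=
  IsState ρ ∧ ∃ r : N → Matrix Q Q ℂ, (∀ x, (r x).PosSemidef) ∧
    ρ = ∑ x, r x ⊗ₖ Matrix.single x x (1 : ℂ)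

/-- The marginal `ρ_Q = Tr_N ρ_{QN}`. -/
def marginal {Q N : Type*} [Fintype N] (ρ : Matrix (Q × N) (Q × N) ℂ) : Matrix Q Q ℂ :=
  Matrix.of fun i j => ∑ x, ρ (i, x) (j, x)

/-- The generalized inverse square root `σ^{-1/2}` of a positive semidefinite matrix: the
eigenvalue `0` is sent to `0`. -/
def invSqrt {Q : Type*} [Fintype Q] [DecidableEq Q] (σ : Matrix Q Q ℂ) : Matrix Q Q ℂ :=
  cfc (fun t : ℝ => (√t)⁻¹) σ

/-- The conditional min-entropy
`H_min(N|Q)_ρ = -log₂ inf_σ ‖(σ^{-1/2} ⊗ 1) ρ (σ^{-1/2} ⊗ 1)‖_∞`, the infimum being over the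
states `σ` of `Q` whose support contains the support of `ρ_Q` (that is, `ker σ ⊆ ker ρ_Q`), as is
needed for the generalized inverse to make sense. -/
def condMinEntropy {Q N : Type*} [Fintype Q] [DecidableEq Q] [Fintype N] [DecidableEq N]
    (ρ : Matrix (Q × N) (Q × N) ℂ) : ℝ :=
  -Real.logb 2 (sInf {t : ℝ | ∃ σ : Matrix Q Q ℂ, IsState σ ∧
    (∀ v : Q → ℂ, σ *ᵥ v = 0 → marginal ρ *ᵥ v = 0) ∧
    t = opNorm ((invSqrt σ ⊗ₖ (1 : Matrix N N ℂ)) * ρ * (invSqrt σ ⊗ₖ (1 : Matrix N N ℂ)))})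

/-- The map `id_Q ⊗ F` for a matrix `F` acting on the classical system `N`:
it sends `∑ₓ ρₓ ⊗ |x⟩⟨x|` to `∑_y (∑ₓ F_{yx} ρₓ) ⊗ |y⟩⟨y|`. -/
def idTensor {Q N M : Type*} [Fintype N] [DecidableEq M] (F : Matrix M N ℂ)
    (ρ : Matrix (Q × N) (Q × N) ℂ) : Matrix (Q × M) (Q × M) ℂ :=
  Matrix.of fun a b => if a.2 = b.2 then ∑ x, F a.2 x * ρ (a.1, x) (b.1, x) else 0

/-- The maximally mixed state. -/
def maxMixed (M : Type*) [Fintype M] [DecidableEq M] : Matrix M M ℂ :=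
  (1 / (Fintype.card M : ℂ)) • (1 : Matrix M M ℂ)

/-- The family `f` of functions `N → M`, indexed by the seeds in `D`, is a quantum-proof
`(k, ε)`-extractor: the quantum system `Q` has arbitrary finite dimension `q`. -/
def IsQuantumProofExtractor {D N M : Type*} [Fintype D] [Fintype N] [DecidableEq N]
    [Fintype M] [DecidableEq M] (f : D → N → M) (k ε : ℝ) : Prop :=
  ∀ (q : ℕ) (ρ : Matrix (Fin q × N) (Fin q × N) ℂ), IsCQState ρ → k ≤ condMinEntropy ρ →
    traceNorm ((1 / (Fintype.card D : ℂ)) • ∑ s, idTensor (funMatrix ℂ (f s)) ρ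
      - marginal ρ ⊗ₖ maxMixed M) ≤ ε

end

end QExt

/-! Write `Δ` for the difference between the averaged matrix of the family and the map to the
uniform distribution. Mixing with the uniform distribution turns the extractor property into
`‖Δ w‖₁ ≤ 2 ε a` for all nonnegative vectors `w` of sum at most `a` and entries at most
`2 ^ (-(k + 1)) a`. If a classical-quantum state with blocks `ρₓ` has conditional min-entropy at
least `k + 1`, some state `σ` satisfies `ρₓ ≤ 2 ^ (-k) • σ` (the infimum need only be attained up to
a factor two). Put `τ = 2 • σ + ρ_Q` and factor `ρₓ = √τ ωₓ √τ`. For every unit vector `v` the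
numbers `⟨v, ωₓ v⟩` form a vector `w` as above with `a = 1`, hence all signed sums `∑ ±B_y` of the
operators `B_y = ∑ₓ Δ_{yx} ωₓ` lie between `-2ε` and `2ε`. Averaging their squares over the signs
gives `∑ B_y² ≤ (2ε)²`. The output minus the ideal output has the blocks `√τ B_y √τ`, so the
Cauchy–Schwarz inequality for the trace bounds its trace norm by `√|M| · 2ε · Tr τ`, and
`Tr τ = 3`. -/

namespace QExt

open scoped MatrixOrder

section Classical

variable {D N M : Type*} [Fintype D] [Fintype N] [Fintype M]

theorem le_minEntropy {P : N → ℝ} (hP : IsProbDist P) {k : ℝ}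
    (h : ∀ x, P x ≤ (2 : ℝ) ^ (-k)) : k ≤ minEntropy P := by
  obtain ⟨x, -, hx⟩ : ∃ x ∈ Finset.univ, 0 < P x :=
    Finset.exists_lt_of_sum_lt (by simp only [Finset.sum_const_zero, hP.2, one_pos])
  have hpos : 0 < ⨆ x, P x := hx.trans_le (le_ciSup (Set.finite_range P).bddAbove x)
  have : Nonempty N := ⟨x⟩
  exact le_neg_of_le_neg ((Real.logb_le_iff_le_rpow one_lt_two hpos).2 (ciSup_le h))

theorem isProbDist_uniform [Nonempty N] : IsProbDist fun _ : N => (Fintype.card N : ℝ)⁻¹ :=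
  ⟨fun _ => by positivity, by simp⟩

theorem seminorm_le_mul_sum {p : Seminorm ℝ (N → ℝ)} {β ε : ℝ}
    (h : ∀ P : N → ℝ, IsProbDist P → (∀ x, P x ≤ β) → p P ≤ ε) {w : N → ℝ}
    (hw : ∀ x, 0 ≤ w x) (hwβ : ∀ x, w x ≤ β * ∑ x', w x') : p w ≤ ε * ∑ x, w x := by
  set s := ∑ x, w x with hs
  have hs0 : 0 ≤ s := Finset.sum_nonneg fun x _ => hw x
  rcases hs0.eq_or_lt with hs0 | hs0
  · have : w = 0 := (Fintype.sum_eq_zero_iff_of_nonneg hw).1 (hs ▸ hs0.symm)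
    simp [this, ← hs0]
  · have hP : IsProbDist (s⁻¹ • w) :=
      ⟨fun x => mul_nonneg (inv_nonneg.2 hs0.le) (hw x), by
        simp only [Pi.smul_apply, smul_eq_mul, ← Finset.mul_sum, ← hs, inv_mul_cancel₀ hs0.ne']⟩
    have hle := h _ hP fun x => (inv_mul_le_iff₀' hs0).2 (hwβ x)
    rwa [map_smul_eq_mul, Real.norm_of_nonneg (inv_nonneg.2 hs0.le), inv_mul_le_iff₀' hs0] at hle

/-- Writing `u` for the uniform distribution, `w = (w + (a - ∑ w) u) - (a - ∑ w) u` is a difference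
of two multiples of distributions with entries at most `2 * κ`, although `∑ w` may be far
below `a`. -/
theorem seminorm_le_two_mul [Nonempty N] {p : Seminorm ℝ (N → ℝ)} {κ ε : ℝ}
    (hκ : (Fintype.card N : ℝ)⁻¹ ≤ κ)
    (h : ∀ P : N → ℝ, IsProbDist P → (∀ x, P x ≤ 2 * κ) → p P ≤ ε) {w : N → ℝ} {a : ℝ}
    (hw : ∀ x, 0 ≤ w x) (hwκ : ∀ x, w x ≤ κ * a) (hwa : ∑ x, w x ≤ a) : p w ≤ 2 * ε * a := by
  have hu := isProbDist_uniform (N := N)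
  set u : N → ℝ := fun _ => (Fintype.card N : ℝ)⁻¹ with hu_def
  set s := ∑ x, w x with hs
  have hκ0 : 0 ≤ κ := (hu.1 (Classical.arbitrary N)).trans hκ
  have hs0 : 0 ≤ s := Finset.sum_nonneg fun x _ => hw x
  have hε : 0 ≤ ε := (apply_nonneg p u).trans (h u hu fun x => by simp only [hu_def]; linarith)
  have hrest : ∀ x, 0 ≤ ((a - s) • u) x := fun x => mul_nonneg (sub_nonneg.2 hwa) (hu.1 x)
  have hrestκ : ∀ x, ((a - s) • u) x ≤ κ * (a - s) := fun x => by
    rw [mul_comm]; exact mul_le_mul_of_nonneg_left hκ (sub_nonneg.2 hwa)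
  have hrest_sum : ∑ x, ((a - s) • u) x = a - s := by
    simp only [Pi.smul_apply, smul_eq_mul, ← Finset.mul_sum, hu.2, mul_one]
  have hmix_sum : ∑ x, (w + (a - s) • u) x = a := by
    simp only [Pi.add_apply, Finset.sum_add_distrib, hrest_sum, ← hs, add_sub_cancel]
  have hrest_le : p ((a - s) • u) ≤ ε * (a - s) := by
    have := seminorm_le_mul_sum h hrest fun x => by
      rw [hrest_sum]; nlinarith [hrestκ x, mul_nonneg hκ0 (sub_nonneg.2 hwa)]
    rwa [hrest_sum] at this
  have hmix_le : p (w + (a - s) • u) ≤ ε * a := by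
    have hmix : ∀ x, 0 ≤ (w + (a - s) • u) x := fun x => add_nonneg (hw x) (hrest x)
    have := seminorm_le_mul_sum h hmix fun x => by
      rw [hmix_sum, Pi.add_apply]; nlinarith [hwκ x, hrestκ x, mul_nonneg hκ0 hs0]
    rwa [hmix_sum] at this
  calc p w = p (w + (a - s) • u - (a - s) • u) := by rw [add_sub_cancel_right]
    _ ≤ p (w + (a - s) • u) + p ((a - s) • u) := map_sub_le_add p _ _
    _ ≤ ε * a + ε * (a - s) := add_le_add hmix_le hrest_le
    _ ≤ 2 * ε * a := by nlinarith [mul_nonneg hε hs0]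

/-- The seminorm `w ↦ ‖Δ w‖_{ℓ₁}`; for `Δ` the bias of a family it measures the distance of the
output from uniform. -/
def l1Seminorm (Δ : Matrix M N ℝ) : Seminorm ℝ (N → ℝ) :=
  Seminorm.of (fun w => ∑ y, |(Δ *ᵥ w) y|)
    (fun v w => by
      simp only [Matrix.mulVec_add, Pi.add_apply, ← Finset.sum_add_distrib]
      exact Finset.sum_le_sum fun y _ => abs_add_le _ _)
    (fun c w => by
      simp only [Matrix.mulVec_smul, Pi.smul_apply, smul_eq_mul, abs_mul, Finset.mul_sum,
        Real.norm_eq_abs])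

theorem l1Seminorm_apply (Δ : Matrix M N ℝ) (w : N → ℝ) :
    l1Seminorm Δ w = ∑ y, |(Δ *ᵥ w) y| := rfl

/-- `Δ` maps the cone of nonnegative vectors to `ℓ₁` with norm at most `K`, where `w` has the norm
`max (∑ₓ w x) (κ⁻¹ maxₓ w x)`, of which `a` is an upper bound; for `κ = 2 ^ (-k)` the distributions
of min-entropy at least `k` are the probability distributions of norm one. This form of the
extractor property passes to operators. -/
def CapBounded (Δ : Matrix M N ℝ) (κ K : ℝ) : Prop :=
  ∀ (w : N → ℝ) (a : ℝ), (∀ x, 0 ≤ w x) → (∀ x, w x ≤ κ * a) → ∑ x, w x ≤ a →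
    l1Seminorm Δ w ≤ K * a

theorem CapBounded.nonneg {Δ : Matrix M N ℝ} {κ K : ℝ} (h : CapBounded Δ κ K) (hκ : 0 ≤ κ) :
    0 ≤ K := by
  simpa using h 0 1 (fun _ => le_rfl) (fun _ => by simpa using hκ) (by simp)

variable [DecidableEq M]

/-- The matrix of the averaged map `2 ^ (-d) ∑ₛ Fₛ`, from which the map that sends every
distribution to the uniform one is subtracted. -/
noncomputable def bias (f : D → N → M) : Matrix M N ℝ :=
  (1 / (Fintype.card D : ℝ)) • ∑ s, funMatrix ℝ (f s)
    - Matrix.of fun _ _ => 1 / (Fintype.card M : ℝ)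

theorem bias_mulVec_of_isProbDist (f : D → N → M) {P : N → ℝ} (hP : IsProbDist P) (y : M) :
    (bias f *ᵥ P) y
      = ((1 / (Fintype.card D : ℝ)) • ∑ s, funMatrix ℝ (f s) *ᵥ P) y
        - 1 / (Fintype.card M : ℝ) := by
  have huniform : ((Matrix.of fun _ _ => 1 / (Fintype.card M : ℝ) : Matrix M N ℝ) *ᵥ P) y
      = 1 / (Fintype.card M : ℝ) := by
    simp only [Matrix.mulVec, dotProduct, Matrix.of_apply, ← Finset.mul_sum, hP.2, mul_one]
  rw [bias, Matrix.sub_mulVec, Matrix.smul_mulVec, Matrix.sum_mulVec, Pi.sub_apply, huniform]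

theorem IsExtractor.capBounded_bias [Nonempty N] {f : D → N → M} {k ε : ℝ}
    (hf : IsExtractor f k ε) (hN : (Fintype.card N : ℝ)⁻¹ ≤ (2 : ℝ) ^ (-(k + 1))) :
    CapBounded (bias f) ((2 : ℝ) ^ (-(k + 1))) (2 * ε) := by
  have htwo : 2 * (2 : ℝ) ^ (-(k + 1)) = 2 ^ (-k) := by
    rw [neg_add, Real.rpow_add two_pos, Real.rpow_neg_one]; ring
  refine fun w a => seminorm_le_two_mul hN fun P hP hPk => ?_
  rw [l1Seminorm_apply]
  simp only [bias_mulVec_of_isProbDist f hP]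
  exact hf P hP (le_minEntropy hP fun x => htwo ▸ hPk x)

end Classical

section SignAverage

theorem add_sum_mul_self_le_of_forall_signs {A ι : Type*} [Ring A] [PartialOrder A]
    [IsOrderedAddMonoid A] [Module ℝ A] [PosSMulMono ℝ A] (B : ι → A) (c : A) (s : Finset ι)
    (X : A) (h : ∀ z : ι → ℤˣ, (X + ∑ i ∈ s, z i • B i) * (X + ∑ i ∈ s, z i • B i) ≤ c) :
    X * X + ∑ i ∈ s, B i * B i ≤ c := by
  classical
  induction s using Finset.induction_on generalizing X with
  | empty => simpa only [Finset.sum_empty, add_zero] using h 1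
  | insert j s hj ih =>
    have hsigned (u : ℤˣ) : (X + u • B j) * (X + u • B j) + ∑ i ∈ s, B i * B i ≤ c := by
      refine ih _ fun z => ?_
      have hsum : ∑ i ∈ s, Function.update z j u i • B i = ∑ i ∈ s, z i • B i :=
        Finset.sum_congr rfl fun i hi => by
          rw [Function.update_of_ne (ne_of_mem_of_not_mem hi hj)]
      have := h (Function.update z j u)
      rwa [Finset.sum_insert hj, Function.update_self, hsum, ← add_assoc] at this
    have hplus := hsigned 1
    have hminus := hsigned (-1)
    rw [one_smul] at hplus
    rw [Units.neg_smul, one_smul] at hminus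
    have hparallelogram :
        (2 : ℝ) • (X * X + ∑ i ∈ insert j s, B i * B i)
          = ((X + B j) * (X + B j) + ∑ i ∈ s, B i * B i)
            + ((X + -B j) * (X + -B j) + ∑ i ∈ s, B i * B i) := by
      rw [Finset.sum_insert hj, two_smul]
      noncomm_ring
    have htwo : (2 : ℝ) • (X * X + ∑ i ∈ insert j s, B i * B i) ≤ (2 : ℝ) • c := by
      rw [hparallelogram, two_smul]
      exact add_le_add hplus hminus
    simpa only [smul_smul, inv_mul_cancel₀ (two_ne_zero' ℝ), one_smul] using
      smul_le_smul_of_nonneg_left htwo (inv_nonneg.2 zero_le_two : (0 : ℝ) ≤ 2⁻¹)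

end SignAverage

section QuadForm

variable {Q : Type*} [Fintype Q]

/-- The real part of the quadratic form `A ↦ ⟨v, A v⟩`, as a functional on matrices. It carries
operator inequalities to inequalities between real numbers. -/
def quadForm (v : Q → ℂ) : Matrix Q Q ℂ →ₗ[ℝ] ℝ where
  toFun A := (star v ⬝ᵥ A *ᵥ v).re
  map_add' A B := by rw [Matrix.add_mulVec, dotProduct_add, Complex.add_re]
  map_smul' c A := by rw [Matrix.smul_mulVec, dotProduct_smul, Complex.smul_re, RingHom.id_apply]

theorem quadForm_mono (v : Q → ℂ) : Monotone (quadForm v) := fun A B hAB => by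
  rw [← sub_nonneg, ← map_sub]
  exact (Matrix.le_iff.1 hAB).re_dotProduct_nonneg v

theorem le_of_forall_quadForm_le {A B : Matrix Q Q ℂ} (hA : A.IsHermitian) (hB : B.IsHermitian)
    (h : ∀ v, quadForm v A ≤ quadForm v B) : A ≤ B := by
  have hBA := hB.sub hA
  refine Matrix.le_iff.2 (Matrix.PosSemidef.of_dotProduct_mulVec_nonneg hBA fun v => ?_)
  refine Complex.le_def.2 ⟨?_, (hBA.im_star_dotProduct_mulVec_self v).symm⟩
  have := sub_nonneg.2 (h v)
  rwa [← map_sub] at this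

variable [DecidableEq Q]

theorem mul_self_le_sq_smul_one {C : Matrix Q Q ℂ} {K : ℝ} (hC : C.IsHermitian)
    (hlower : -(K • 1) ≤ C) (hupper : C ≤ K • 1) : C * C ≤ K ^ 2 • 1 := by
  have hself : IsSelfAdjoint C := hC
  rw [← neg_smul, ← Algebra.algebraMap_eq_smul_one, algebraMap_le_iff_le_spectrum] at hlower
  rw [← Algebra.algebraMap_eq_smul_one, le_algebraMap_iff_spectrum_le] at hupper
  rw [← sq, ← cfc_pow_id (R := ℝ) C 2, ← Algebra.algebraMap_eq_smul_one]
  exact cfc_le_algebraMap _ _ _ fun x hx => sq_le_sq' (hlower x hx) (hupper x hx)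

variable {N M : Type*} [Fintype N] [Fintype M] {Δ : Matrix M N ℝ} {κ K : ℝ}
  {ω : N → Matrix Q Q ℂ}

theorem CapBounded.abs_quadForm_sum_signs_le (hΔ : CapBounded Δ κ K) (hω : ∀ x, 0 ≤ ω x)
    (hωκ : ∀ x, ω x ≤ κ • 1) (hω1 : ∑ x, ω x ≤ 1) (z : M → ℤˣ) (v : Q → ℂ) :
    |quadForm v (∑ y, z y • ∑ x, Δ y x • ω x)| ≤ quadForm v (K • 1) := by
  have hbound : ∑ y, |(Δ *ᵥ fun x => quadForm v (ω x)) y| ≤ K * quadForm v 1 := by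
    refine hΔ _ _ (fun x => ?_) (fun x => ?_) ?_
    · simpa only [map_zero] using quadForm_mono v (hω x)
    · simpa only [map_smul, smul_eq_mul] using quadForm_mono v (hωκ x)
    · simpa only [map_sum] using quadForm_mono v hω1
  have hterm (y : M) : |quadForm v (z y • ∑ x, Δ y x • ω x)|
      = |(Δ *ᵥ fun x => quadForm v (ω x)) y| := by
    have : quadForm v (∑ x, Δ y x • ω x) = (Δ *ᵥ fun x => quadForm v (ω x)) y := by
      simp only [map_sum, map_smul, smul_eq_mul, Matrix.mulVec, dotProduct]
    rcases Int.units_eq_one_or (z y) with hz | hz <;>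
      simp only [hz, one_smul, Units.neg_smul, map_neg, abs_neg, this]
  rw [map_sum, map_smul, smul_eq_mul]
  exact (Finset.abs_sum_le_sum_abs _ _).trans (by simpa only [hterm] using hbound)

theorem CapBounded.sum_mul_self_le (hΔ : CapBounded Δ κ K) (hω : ∀ x, 0 ≤ ω x)
    (hωκ : ∀ x, ω x ≤ κ • 1) (hω1 : ∑ x, ω x ≤ 1) :
    ∑ y, (∑ x, Δ y x • ω x) * ∑ x, Δ y x • ω x ≤ K ^ 2 • 1 := by
  have hsigned (z : M → ℤˣ) : (∑ y, z y • ∑ x, Δ y x • ω x).IsHermitian := by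
    refine isSelfAdjoint_sum _ fun y _ => ?_
    have : IsSelfAdjoint (∑ x, Δ y x • ω x) :=
      isSelfAdjoint_sum _ fun x _ => (IsSelfAdjoint.all _).smul (IsSelfAdjoint.of_nonneg (hω x))
    rcases Int.units_eq_one_or (z y) with hz | hz
    · rwa [hz, one_smul]
    · rw [hz, Units.neg_smul, one_smul]; exact this.neg
  have hK : (K • (1 : Matrix Q Q ℂ)).IsHermitian :=
    (IsSelfAdjoint.all K).smul (IsSelfAdjoint.one _)
  have habs := hΔ.abs_quadForm_sum_signs_le hω hωκ hω1
  have := add_sum_mul_self_le_of_forall_signs (fun y => ∑ x, Δ y x • ω x) (K ^ 2 • 1)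
    Finset.univ 0 fun z => by
      rw [zero_add]
      refine mul_self_le_sq_smul_one (hsigned z)
        (le_of_forall_quadForm_le hK.neg (hsigned z) fun v => ?_)
        (le_of_forall_quadForm_le (hsigned z) hK fun v => (abs_le.1 (habs z v)).2)
      rw [map_neg]
      exact (abs_le.1 (habs z v)).1
  simpa only [mul_zero, zero_add] using this

end QuadForm

section InvSqrt

variable {Q : Type*} [Fintype Q]

theorem mulVec_eq_zero_of_nonneg_of_le {A B : Matrix Q Q ℂ} (hA : 0 ≤ A) (hAB : A ≤ B)
    {v : Q → ℂ} (hv : B *ᵥ v = 0) : A *ᵥ v = 0 := by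
  have hBA := (Matrix.le_iff.1 hAB).dotProduct_mulVec_nonneg v
  rw [Matrix.sub_mulVec, hv, zero_sub, dotProduct_neg, neg_nonneg] at hBA
  have hA_psd := Matrix.nonneg_iff_posSemidef.1 hA
  exact (hA_psd.dotProduct_mulVec_zero_iff v).1
    (hBA.antisymm (hA_psd.dotProduct_mulVec_nonneg v))

variable [DecidableEq Q] {σ ρ : Matrix Q Q ℂ}

theorem cfc_mul_cfc (f g : ℝ → ℝ) (σ : Matrix Q Q ℂ) :
    cfc f σ * cfc g σ = cfc (fun t => f t * g t) σ :=
  (cfc_mul f g σ (Matrix.finite_real_spectrum.continuousOn f)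
    (Matrix.finite_real_spectrum.continuousOn g)).symm

theorem sqrt_mul_sqrt (hσ : 0 ≤ σ) : cfc Real.sqrt σ * cfc Real.sqrt σ = σ := by
  have hself : IsSelfAdjoint σ := .of_nonneg hσ
  rw [cfc_mul_cfc, cfc_congr fun t ht => Real.mul_self_sqrt (spectrum_nonneg_of_nonneg hσ ht),
    cfc_id' ℝ σ]

theorem invSqrt_mul_sqrt_mul_invSqrt (σ : Matrix Q Q ℂ) :
    invSqrt σ * cfc Real.sqrt σ * invSqrt σ = invSqrt σ := by
  have hinv (t : ℝ) : (√t)⁻¹ * √t * (√t)⁻¹ = (√t)⁻¹ := by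
    simpa only [inv_inv] using mul_inv_mul_cancel (√t)⁻¹
  simp only [invSqrt, cfc_mul_cfc, hinv]

theorem sqrt_mul_invSqrt_mul_sqrt (σ : Matrix Q Q ℂ) :
    cfc Real.sqrt σ * invSqrt σ * cfc Real.sqrt σ = cfc Real.sqrt σ := by
  simp only [invSqrt, cfc_mul_cfc, mul_inv_mul_cancel]

theorem commute_invSqrt_sqrt (σ : Matrix Q Q ℂ) : Commute (invSqrt σ) (cfc Real.sqrt σ) :=
  cfc_commute_cfc _ _ σ

theorem isSelfAdjoint_sqrt (σ : Matrix Q Q ℂ) : IsSelfAdjoint (cfc Real.sqrt σ) := .cfc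

theorem isSelfAdjoint_invSqrt (σ : Matrix Q Q ℂ) : IsSelfAdjoint (invSqrt σ) := .cfc

theorem isStarProjection_invSqrt_mul_sqrt (σ : Matrix Q Q ℂ) :
    IsStarProjection (invSqrt σ * cfc Real.sqrt σ) where
  isIdempotentElem := by
    rw [IsIdempotentElem, ← mul_assoc, invSqrt_mul_sqrt_mul_invSqrt]
  isSelfAdjoint := by
    rw [IsSelfAdjoint, star_mul, isSelfAdjoint_sqrt, isSelfAdjoint_invSqrt,
      commute_invSqrt_sqrt]

theorem invSqrt_mul_self_mul_invSqrt (hσ : 0 ≤ σ) :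
    invSqrt σ * σ * invSqrt σ = invSqrt σ * cfc Real.sqrt σ := by
  calc invSqrt σ * σ * invSqrt σ
      = invSqrt σ * (cfc Real.sqrt σ * cfc Real.sqrt σ) * invSqrt σ := by rw [sqrt_mul_sqrt hσ]
    _ = invSqrt σ * cfc Real.sqrt σ * (cfc Real.sqrt σ * invSqrt σ) := by simp only [mul_assoc]
    _ = invSqrt σ * cfc Real.sqrt σ := by
        rw [← commute_invSqrt_sqrt, (isStarProjection_invSqrt_mul_sqrt σ).isIdempotentElem]

theorem mul_invSqrt_mul_sqrt_of_ker (hσ : 0 ≤ σ) (hker : ∀ v, σ *ᵥ v = 0 → ρ *ᵥ v = 0) :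
    ρ * (invSqrt σ * cfc Real.sqrt σ) = ρ := by
  have hσ_zero : σ * (1 - invSqrt σ * cfc Real.sqrt σ) = 0 := by
    nth_rw 1 [← sqrt_mul_sqrt hσ]
    rw [mul_assoc, mul_sub, mul_one, ← mul_assoc _ (invSqrt σ), sqrt_mul_invSqrt_mul_sqrt,
      sub_self, mul_zero]
  have hρ_zero : ρ * (1 - invSqrt σ * cfc Real.sqrt σ) = 0 := by
    refine Matrix.ext_of_mulVec_single fun i => ?_
    rw [← Matrix.mulVec_mulVec, Matrix.zero_mulVec]
    exact hker _ (by rw [Matrix.mulVec_mulVec, hσ_zero, Matrix.zero_mulVec])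
  rw [mul_sub, mul_one, sub_eq_zero] at hρ_zero
  exact hρ_zero.symm

theorem sqrt_mul_invSqrt_conj_mul_sqrt (hσ : 0 ≤ σ) (hρ : IsSelfAdjoint ρ)
    (hker : ∀ v, σ *ᵥ v = 0 → ρ *ᵥ v = 0) :
    cfc Real.sqrt σ * (invSqrt σ * ρ * invSqrt σ) * cfc Real.sqrt σ = ρ := by
  have hright := mul_invSqrt_mul_sqrt_of_ker hσ hker
  have hleft := congrArg star hright
  rw [star_mul, (isStarProjection_invSqrt_mul_sqrt σ).isSelfAdjoint.star_eq, hρ.star_eq,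
    commute_invSqrt_sqrt] at hleft
  calc cfc Real.sqrt σ * (invSqrt σ * ρ * invSqrt σ) * cfc Real.sqrt σ
      = cfc Real.sqrt σ * invSqrt σ * (ρ * (invSqrt σ * cfc Real.sqrt σ)) := by
        simp only [mul_assoc]
    _ = ρ := by rw [hright, hleft]

theorem invSqrt_conj_le_one (hσ : 0 ≤ σ) (h : ρ ≤ σ) : invSqrt σ * ρ * invSqrt σ ≤ 1 :=
  calc invSqrt σ * ρ * invSqrt σ
      ≤ invSqrt σ * σ * invSqrt σ := (isSelfAdjoint_invSqrt σ).conjugate_le_conjugate h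
    _ = invSqrt σ * cfc Real.sqrt σ := invSqrt_mul_self_mul_invSqrt hσ
    _ ≤ 1 := (isStarProjection_invSqrt_mul_sqrt σ).le_one

theorem invSqrt_conj_le_smul_one (hσ : 0 ≤ σ) {κ : ℝ} (hκ : 0 ≤ κ) (h : ρ ≤ κ • σ) :
    invSqrt σ * ρ * invSqrt σ ≤ κ • 1 :=
  calc invSqrt σ * ρ * invSqrt σ
      ≤ invSqrt σ * κ • σ * invSqrt σ := (isSelfAdjoint_invSqrt σ).conjugate_le_conjugate h
    _ = κ • (invSqrt σ * σ * invSqrt σ) := by rw [mul_smul_comm, smul_mul_assoc]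
    _ ≤ κ • 1 := smul_le_smul_of_nonneg_left (invSqrt_conj_le_one hσ le_rfl) hκ

theorem le_smul_of_invSqrt_conj_le_smul_one (hσ : 0 ≤ σ) (hρ : IsSelfAdjoint ρ)
    (hker : ∀ v, σ *ᵥ v = 0 → ρ *ᵥ v = 0) {t : ℝ} (h : invSqrt σ * ρ * invSqrt σ ≤ t • 1) :
    ρ ≤ t • σ :=
  calc ρ = cfc Real.sqrt σ * (invSqrt σ * ρ * invSqrt σ) * cfc Real.sqrt σ :=
        (sqrt_mul_invSqrt_conj_mul_sqrt hσ hρ hker).symm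
    _ ≤ cfc Real.sqrt σ * t • 1 * cfc Real.sqrt σ :=
        (isSelfAdjoint_sqrt σ).conjugate_le_conjugate h
    _ = t • σ := by rw [mul_smul_comm, mul_one, smul_mul_assoc, sqrt_mul_sqrt hσ]

end InvSqrt

section TraceNorm

variable {Q M : Type*} [Fintype Q] [Fintype M]

theorem re_trace_mono : Monotone fun A : Matrix Q Q ℂ => A.trace.re := fun A B hAB => by
  rw [← sub_nonneg, ← Complex.sub_re, ← Matrix.trace_sub]
  exact (Complex.le_def.1 (Matrix.le_iff.1 hAB).trace_nonneg).1

theorem re_trace_conjTranspose_mul_le (A B : Matrix Q Q ℂ) :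
    (Aᴴ * B).trace.re ≤ √(Aᴴ * A).trace.re * √(Bᴴ * B).trace.re := by
  have hinner (C D : Matrix Q Q ℂ) :
      (Cᴴ * D).trace = inner ℂ (WithLp.toLp 2 C.vec) (WithLp.toLp 2 D.vec) := by
    rw [EuclideanSpace.inner_toLp_toLp, dotProduct_comm, Matrix.star_vec_dotProduct_vec]
  rw [hinner, hinner, hinner]
  simp only [← RCLike.re_eq_complex_re, ← norm_eq_sqrt_re_inner]
  exact re_inner_le_norm _ _

variable [DecidableEq Q]

/-- The partial isometry `V` of the polar decomposition is `X * (Xᴴ * X) ^ (-1/2)`. -/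
theorem exists_conjTranspose_mul_eq_sqrt (X : Matrix Q Q ℂ) :
    ∃ V : Matrix Q Q ℂ, Vᴴ * X = cfc Real.sqrt (Xᴴ * X) ∧ V * Vᴴ ≤ 1 := by
  have hpos : 0 ≤ Xᴴ * X := star_mul_self_nonneg X
  set T := invSqrt (Xᴴ * X) with hT
  have hT_star : Tᴴ = T := isSelfAdjoint_invSqrt _
  have hVV : X * T * (X * T)ᴴ = X * (T * T) * Xᴴ := by
    rw [Matrix.conjTranspose_mul, hT_star]
    simp only [mul_assoc]
  refine ⟨X * T, ?_, IsStarProjection.le_one ⟨?_, .mul_star_self (X * T)⟩⟩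
  · rw [Matrix.conjTranspose_mul, hT_star, mul_assoc]
    nth_rw 1 [← sqrt_mul_sqrt hpos]
    rw [← mul_assoc, commute_invSqrt_sqrt, sqrt_mul_invSqrt_mul_sqrt]
  · calc X * T * (X * T)ᴴ * (X * T * (X * T)ᴴ)
        = X * (T * (T * (Xᴴ * X) * T) * T) * Xᴴ := by
          rw [hVV]
          simp only [mul_assoc]
      _ = X * (T * T) * Xᴴ := by
          rw [hT, invSqrt_mul_self_mul_invSqrt hpos, mul_assoc (invSqrt _) (_ * _),
            invSqrt_mul_sqrt_mul_invSqrt]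
      _ = X * T * (X * T)ᴴ := hVV.symm

theorem traceNorm_conjTranspose_mul_le (S W : Matrix Q Q ℂ) :
    traceNorm (Sᴴ * W) ≤ √(Sᴴ * S).trace.re * √(Wᴴ * W).trace.re := by
  obtain ⟨V, hV, hV_le⟩ := exists_conjTranspose_mul_eq_sqrt (Sᴴ * W)
  have hSV : ((S * V)ᴴ * (S * V)).trace.re ≤ (Sᴴ * S).trace.re :=
    calc ((S * V)ᴴ * (S * V)).trace.re
        = (S * (V * Vᴴ) * Sᴴ).trace.re := by
          rw [Matrix.trace_mul_comm, Matrix.conjTranspose_mul]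
          simp only [mul_assoc]
      _ ≤ (S * 1 * Sᴴ).trace.re := re_trace_mono (star_right_conjugate_le_conjugate hV_le S)
      _ = (Sᴴ * S).trace.re := by rw [mul_one, Matrix.trace_mul_comm]
  calc traceNorm (Sᴴ * W)
      = ((S * V)ᴴ * W).trace.re := by
        rw [traceNorm, ← hV, Matrix.conjTranspose_mul, mul_assoc]
    _ ≤ √((S * V)ᴴ * (S * V)).trace.re * √(Wᴴ * W).trace.re := re_trace_conjTranspose_mul_le _ _
    _ ≤ √(Sᴴ * S).trace.re * √(Wᴴ * W).trace.re := by gcongr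

variable [DecidableEq M]

theorem traceNorm_blockDiagonal_conj_le {B : M → Matrix Q Q ℂ} {K : ℝ} (hK : 0 ≤ K)
    (hB : ∑ y, (B y)ᴴ * B y ≤ K ^ 2 • 1) (S : Matrix Q Q ℂ) :
    traceNorm (Matrix.blockDiagonal fun y => Sᴴ * B y * S)
      ≤ √(Fintype.card M) * K * (Sᴴ * S).trace.re := by
  set a := (Sᴴ * S).trace.re
  have ha : 0 ≤ a := by
    simpa only [Matrix.trace_zero, Complex.zero_re, Matrix.star_eq_conjTranspose] using
      re_trace_mono (star_mul_self_nonneg S)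
  have hfactor : (Matrix.blockDiagonal fun y => Sᴴ * B y * S)
      = (Matrix.blockDiagonal fun _ : M => S)ᴴ * Matrix.blockDiagonal fun y => B y * S := by
    simp only [Matrix.blockDiagonal_conjTranspose, ← Matrix.blockDiagonal_mul, mul_assoc]
  have hS : ((Matrix.blockDiagonal fun _ : M => S)ᴴ * Matrix.blockDiagonal fun _ => S).trace.re
      = Fintype.card M * a := by
    rw [Matrix.blockDiagonal_conjTranspose, ← Matrix.blockDiagonal_mul,
      Matrix.trace_blockDiagonal, Finset.sum_const, Finset.card_univ, Complex.smul_re,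
      nsmul_eq_mul]
  have hBS : ((Matrix.blockDiagonal fun y => B y * S)ᴴ
      * Matrix.blockDiagonal fun y => B y * S).trace.re ≤ K ^ 2 * a :=
    calc ((Matrix.blockDiagonal fun y => B y * S)ᴴ
          * Matrix.blockDiagonal fun y => B y * S).trace.re
        = (Sᴴ * (∑ y, (B y)ᴴ * B y) * S).trace.re := by
          simp only [Matrix.blockDiagonal_conjTranspose, ← Matrix.blockDiagonal_mul,
            Matrix.trace_blockDiagonal, Matrix.conjTranspose_mul, Finset.mul_sum, Finset.sum_mul,
            Matrix.trace_sum, mul_assoc]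
      _ ≤ (Sᴴ * K ^ 2 • 1 * S).trace.re := re_trace_mono (star_left_conjugate_le_conjugate hB S)
      _ = K ^ 2 * a := by
          rw [mul_smul_comm, mul_one, smul_mul_assoc, Matrix.trace_smul, Complex.smul_re,
            smul_eq_mul]
  calc traceNorm (Matrix.blockDiagonal fun y => Sᴴ * B y * S)
      ≤ √(Fintype.card M * a) * √(K ^ 2 * a) := by
        rw [hfactor, ← hS]
        exact (traceNorm_conjTranspose_mul_le _ _).trans (by gcongr)
    _ = √(Fintype.card M) * K * a := by
        rw [Real.sqrt_mul (Nat.cast_nonneg _), Real.sqrt_mul (sq_nonneg K), Real.sqrt_sq hK]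
        linear_combination √(Fintype.card M) * K * Real.mul_self_sqrt ha

end TraceNorm

section CapBounded

variable {N M Q : Type*} [Fintype N] [Fintype M] [DecidableEq M] [Fintype Q] [DecidableEq Q]

theorem CapBounded.traceNorm_blockDiagonal_le {Δ : Matrix M N ℝ} {κ K : ℝ}
    (hΔ : CapBounded Δ κ K) (hκ : 0 ≤ κ) {r : N → Matrix Q Q ℂ} {τ : Matrix Q Q ℂ}
    (hr : ∀ x, 0 ≤ r x) (hrκ : ∀ x, r x ≤ κ • τ) (hrτ : ∑ x, r x ≤ τ) :
    traceNorm (Matrix.blockDiagonal fun y => ∑ x, Δ y x • r x)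
      ≤ √(Fintype.card M) * K * τ.trace.re := by
  have hτ : 0 ≤ τ := (Finset.sum_nonneg fun x _ => hr x).trans hrτ
  set S := cfc Real.sqrt τ
  have hS : Sᴴ = S := isSelfAdjoint_sqrt τ
  set ω : N → Matrix Q Q ℂ := fun x => invSqrt τ * r x * invSqrt τ with hω_def
  have hω (x : N) : 0 ≤ ω x := (isSelfAdjoint_invSqrt τ).conjugate_nonneg (hr x)
  have hωκ (x : N) : ω x ≤ κ • 1 := invSqrt_conj_le_smul_one hτ hκ (hrκ x)
  have hω1 : ∑ x, ω x ≤ 1 := by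
    rw [hω_def, ← Finset.sum_mul, ← Finset.mul_sum]
    exact invSqrt_conj_le_one hτ hrτ
  have hfactor (y : M) : ∑ x, Δ y x • r x = Sᴴ * (∑ x, Δ y x • ω x) * S := by
    simp only [hS, Finset.mul_sum, Finset.sum_mul, mul_smul_comm, smul_mul_assoc]
    refine Finset.sum_congr rfl fun x _ => congrArg _ (Eq.symm ?_)
    refine sqrt_mul_invSqrt_conj_mul_sqrt hτ (.of_nonneg (hr x)) fun v hv => ?_
    refine mulVec_eq_zero_of_nonneg_of_le (hr x) (hrκ x) ?_
    rw [Matrix.smul_mulVec, hv, smul_zero]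
  have hsq : ∑ y, (∑ x, Δ y x • ω x)ᴴ * ∑ x, Δ y x • ω x ≤ K ^ 2 • 1 := by
    have hherm (y : M) : (∑ x, Δ y x • ω x)ᴴ = ∑ x, Δ y x • ω x :=
      isSelfAdjoint_sum _ fun x _ => (IsSelfAdjoint.all _).smul (.of_nonneg (hω x))
    simpa only [hherm] using hΔ.sum_mul_self_le hω hωκ hω1
  simp only [hfactor]
  refine (traceNorm_blockDiagonal_conj_le (hΔ.nonneg hκ) hsq S).trans_eq ?_
  rw [hS, sqrt_mul_sqrt hτ]

end CapBounded

section ClassicalQuantum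

variable {D N M Q : Type*} [Fintype N] [DecidableEq N] [DecidableEq M]

theorem sum_kronecker_single_eq_blockDiagonal (r : N → Matrix Q Q ℂ) :
    ∑ x, r x ⊗ₖ Matrix.single x x (1 : ℂ) = Matrix.blockDiagonal r := by
  ext ⟨i, x⟩ ⟨j, y⟩
  by_cases h : x = y
  · simp [h, Matrix.sum_apply, Matrix.blockDiagonal_apply, Matrix.single_apply]
  · simp [h, Matrix.sum_apply, Matrix.blockDiagonal_apply, Matrix.single_apply, ite_and]

theorem marginal_blockDiagonal (r : N → Matrix Q Q ℂ) :
    marginal (Matrix.blockDiagonal r) = ∑ x, r x := by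
  ext i j
  simp only [marginal, Matrix.of_apply, Matrix.blockDiagonal_apply_eq, Matrix.sum_apply]

theorem funMatrix_complex_eq_map {L : Type*} (f : L → M) :
    funMatrix ℂ f = (funMatrix ℝ f).map Complex.ofReal := by
  ext y x
  simp only [funMatrix, Matrix.of_apply, Matrix.map_apply, apply_ite Complex.ofReal,
    Complex.ofReal_one, Complex.ofReal_zero]

theorem idTensor_blockDiagonal (F : Matrix M N ℝ) (r : N → Matrix Q Q ℂ) :
    idTensor (F.map Complex.ofReal) (Matrix.blockDiagonal r)
      = Matrix.blockDiagonal fun y => ∑ x, F y x • r x := by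
  ext ⟨i, y⟩ ⟨j, y'⟩
  simp only [idTensor, Matrix.of_apply, Matrix.map_apply, Matrix.blockDiagonal_apply,
    Matrix.sum_apply, Matrix.smul_apply, Complex.real_smul, if_true]

variable [Fintype M]

theorem kronecker_maxMixed (A : Matrix Q Q ℂ) :
    A ⊗ₖ maxMixed M = Matrix.blockDiagonal fun _ => (1 / (Fintype.card M : ℝ)) • A := by
  rw [maxMixed, Matrix.kronecker_smul, Matrix.kronecker_one, ← Matrix.blockDiagonal_smul]
  refine congrArg _ (funext fun _ => ?_)
  rw [← Complex.coe_smul, Complex.ofReal_div, Complex.ofReal_one, Complex.ofReal_natCast,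
    Pi.smul_apply]

theorem output_sub_eq_blockDiagonal [Fintype D] (f : D → N → M) (r : N → Matrix Q Q ℂ) :
    (1 / (Fintype.card D : ℂ)) • ∑ s, idTensor (funMatrix ℂ (f s)) (Matrix.blockDiagonal r)
        - marginal (Matrix.blockDiagonal r) ⊗ₖ maxMixed M
      = Matrix.blockDiagonal fun y => ∑ x, bias f y x • r x := by
  have hsum (g : D → M → Matrix Q Q ℂ) :
      ∑ s, Matrix.blockDiagonal (g s) = Matrix.blockDiagonal (∑ s, g s) :=
    (map_sum (Matrix.blockDiagonalAddMonoidHom Q Q M ℂ) g _).symm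
  have hcast : 1 / (Fintype.card D : ℂ) = ((1 / (Fintype.card D : ℝ) : ℝ) : ℂ) := by
    push_cast
    rfl
  simp only [funMatrix_complex_eq_map, idTensor_blockDiagonal, marginal_blockDiagonal,
    kronecker_maxMixed, hsum, hcast, Complex.coe_smul, ← Matrix.blockDiagonal_smul,
    ← Matrix.blockDiagonal_sub]
  refine congrArg _ (funext fun y => ?_)
  simp only [bias, Pi.sub_apply, Pi.smul_apply, Finset.sum_apply, Matrix.sub_apply,
    Matrix.smul_apply, Matrix.sum_apply, Matrix.of_apply, sub_smul, Finset.sum_sub_distrib,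
    smul_assoc, Finset.sum_smul, Finset.smul_sum]
  rw [Finset.sum_comm]

end ClassicalQuantum

section CondMinEntropy

variable {N Q : Type*} [Fintype N] [Fintype Q]

theorem IsState.nonempty {ρ : Matrix Q Q ℂ} (h : IsState ρ) : Nonempty Q := by
  by_contra hQ
  rw [not_nonempty_iff] at hQ
  simpa only [Matrix.trace, Finset.univ_eq_empty, Finset.sum_empty, zero_ne_one] using h.2

theorem inv_card_le_of_le_smul [Nonempty N] {r : N → Matrix Q Q ℂ} {σ : Matrix Q Q ℂ} {t : ℝ}
    (hr : (∑ x, r x).trace = 1) (hσ : σ.trace = 1) (h : ∀ x, r x ≤ t • σ) :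
    (Fintype.card N : ℝ)⁻¹ ≤ t := by
  have htrace : (∑ x, r x).trace.re ≤ (∑ _ : N, t • σ).trace.re :=
    re_trace_mono (Finset.sum_le_sum fun x _ => h x)
  rw [hr, Finset.sum_const, Finset.card_univ, Matrix.trace_smul, Matrix.trace_smul, hσ,
    Complex.smul_re, Complex.smul_re, Complex.one_re, nsmul_eq_mul, smul_eq_mul, mul_one] at htrace
  exact (inv_le_iff_one_le_mul₀' (by positivity)).2 htrace

variable [DecidableEq Q]

open scoped Matrix.Norms.L2Operator in
theorem le_opNorm_smul_one {A : Matrix Q Q ℂ} (hA : IsSelfAdjoint A) : A ≤ opNorm A • 1 := by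
  rw [← Algebra.algebraMap_eq_smul_one]
  exact hA.le_algebraMap_norm_self

variable [DecidableEq N]

theorem le_opNorm_smul_of_ker {r : N → Matrix Q Q ℂ} (hr : ∀ x, 0 ≤ r x) {σ : Matrix Q Q ℂ}
    (hσ : 0 ≤ σ) (hker : ∀ v, σ *ᵥ v = 0 → marginal (Matrix.blockDiagonal r) *ᵥ v = 0) (x : N) :
    r x ≤ opNorm ((invSqrt σ ⊗ₖ (1 : Matrix N N ℂ)) * Matrix.blockDiagonal r
      * (invSqrt σ ⊗ₖ (1 : Matrix N N ℂ))) • σ := by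
  rw [marginal_blockDiagonal] at hker
  have hr_self (x : N) : IsSelfAdjoint (r x) := .of_nonneg (hr x)
  have hr_le : r x ≤ ∑ x, r x := Finset.single_le_sum (fun x _ => hr x) (Finset.mem_univ x)
  refine le_smul_of_invSqrt_conj_le_smul_one hσ (hr_self x)
    (fun v hv => mulVec_eq_zero_of_nonneg_of_le (hr x) hr_le (hker v hv)) ?_
  rw [Matrix.kronecker_one, ← Matrix.blockDiagonal_mul, ← Matrix.blockDiagonal_mul]
  have hself : IsSelfAdjoint (Matrix.blockDiagonal fun x => invSqrt σ * r x * invSqrt σ) := by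
    rw [IsSelfAdjoint, Matrix.star_eq_conjTranspose, Matrix.blockDiagonal_conjTranspose]
    exact congrArg _ (funext fun x => (hr_self x).conjugate_self (isSelfAdjoint_invSqrt σ))
  have hblock := (Matrix.le_iff.1 (le_opNorm_smul_one hself)).submatrix fun i : Q => (i, x)
  refine Matrix.le_iff.2 ?_
  convert hblock using 1
  ext i j
  simp only [Matrix.sub_apply, Matrix.smul_apply, Matrix.submatrix_apply, Matrix.one_apply,
    Prod.mk.injEq, and_true, Matrix.blockDiagonal_apply_eq]

theorem exists_state_of_le_condMinEntropy [Nonempty N] {r : N → Matrix Q Q ℂ}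
    (hr : ∀ x, 0 ≤ r x) (htr : (∑ x, r x).trace = 1) {l : ℝ}
    (hl : l ≤ condMinEntropy (Matrix.blockDiagonal r)) :
    (Fintype.card N : ℝ)⁻¹ ≤ (2 : ℝ) ^ (-l) ∧
      ∀ t > (2 : ℝ) ^ (-l), ∃ σ : Matrix Q Q ℂ, IsState σ ∧ ∀ x, r x ≤ t • σ := by
  rw [condMinEntropy] at hl
  set T : Set ℝ := {t : ℝ | ∃ σ : Matrix Q Q ℂ, IsState σ ∧
    (∀ v : Q → ℂ, σ *ᵥ v = 0 → marginal (Matrix.blockDiagonal r) *ᵥ v = 0) ∧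
    t = opNorm ((invSqrt σ ⊗ₖ (1 : Matrix N N ℂ)) * Matrix.blockDiagonal r
      * (invSqrt σ ⊗ₖ (1 : Matrix N N ℂ)))}
  have hdom : ∀ t ∈ T, ∃ σ : Matrix Q Q ℂ, IsState σ ∧ ∀ x, r x ≤ t • σ := by
    rintro t ⟨σ, hσ, hker, rfl⟩
    exact ⟨σ, hσ, le_opNorm_smul_of_ker hr hσ.1.nonneg hker⟩
  have hmarginal : IsState (marginal (Matrix.blockDiagonal r)) := by
    rw [marginal_blockDiagonal]
    exact ⟨Matrix.nonneg_iff_posSemidef.1 (Finset.sum_nonneg fun x _ => hr x), htr⟩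
  have hT : T.Nonempty := ⟨_, _, hmarginal, fun _ => id, rfl⟩
  have hcard : (Fintype.card N : ℝ)⁻¹ ≤ sInf T := le_csInf hT fun t ht =>
    have ⟨_, hσ, hrσ⟩ := hdom t ht
    inv_card_le_of_le_smul htr hσ.2 hrσ
  have hsInf : sInf T ≤ (2 : ℝ) ^ (-l) :=
    (Real.logb_le_iff_le_rpow one_lt_two ((inv_pos.2 (by positivity)).trans_le hcard)).1
      (le_neg_of_le_neg hl)
  refine ⟨hcard.trans hsInf, fun t ht => ?_⟩
  obtain ⟨t', ht', hlt⟩ := exists_lt_of_csInf_lt hT (hsInf.trans_lt ht)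
  obtain ⟨σ, hσ, hrσ⟩ := hdom t' ht'
  exact ⟨σ, hσ, fun x => (hrσ x).trans (smul_le_smul_of_nonneg_right hlt.le hσ.1.nonneg)⟩

end CondMinEntropy

section Extractor

variable {D N M Q : Type*} [Fintype D] [Fintype N] [DecidableEq N] [Fintype M] [DecidableEq M]
  [Fintype Q] [DecidableEq Q]

theorem IsExtractor.traceNorm_blockDiagonal_bias_le [Nonempty N] {f : D → N → M} {k ε : ℝ}
    (hf : IsExtractor f k ε) {r : N → Matrix Q Q ℂ} (hr : ∀ x, 0 ≤ r x)
    (htr : (∑ x, r x).trace = 1) (hk : k + 1 ≤ condMinEntropy (Matrix.blockDiagonal r)) :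
    traceNorm (Matrix.blockDiagonal fun y => ∑ x, bias f y x • r x)
      ≤ 6 * √(Fintype.card M) * ε := by
  obtain ⟨hN, hstate⟩ := exists_state_of_le_condMinEntropy hr htr hk
  set κ : ℝ := 2 ^ (-(k + 1))
  have hκ : 0 < κ := by positivity
  obtain ⟨σ, hσ, hrσ⟩ := hstate (κ * 2) (lt_mul_of_one_lt_right hκ one_lt_two)
  have hρ : 0 ≤ ∑ x, r x := Finset.sum_nonneg fun x _ => hr x
  have hσ2 : 0 ≤ (2 : ℝ) • σ := smul_nonneg zero_le_two hσ.1.nonneg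
  have hrτ (x : N) : r x ≤ κ • ((2 : ℝ) • σ + ∑ x, r x) :=
    calc r x ≤ κ • (2 : ℝ) • σ := by rw [smul_smul]; exact hrσ x
      _ ≤ κ • ((2 : ℝ) • σ + ∑ x, r x) :=
          smul_le_smul_of_nonneg_left (le_add_of_nonneg_right hρ) hκ.le
  have htrace : ((2 : ℝ) • σ + ∑ x, r x).trace.re = 3 := by
    rw [Matrix.trace_add, Matrix.trace_smul, hσ.2, htr, Complex.add_re, Complex.smul_re,
      Complex.one_re]
    norm_num
  calc traceNorm (Matrix.blockDiagonal fun y => ∑ x, bias f y x • r x)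
      ≤ √(Fintype.card M) * (2 * ε) * ((2 : ℝ) • σ + ∑ x, r x).trace.re :=
        (hf.capBounded_bias hN).traceNorm_blockDiagonal_le hκ.le hr hrτ
          (le_add_of_nonneg_left hσ2)
    _ = 6 * √(Fintype.card M) * ε := by rw [htrace]; ring

end Extractor

end QExt

theorem mainTheorem9_general {D N M : Type*} [Fintype D] [Nonempty D] [Fintype N] [DecidableEq N]
    [Fintype M] [DecidableEq M] {f : D → N → M} {k ε : ℝ} (hf : QExt.IsExtractor f k ε) :
    QExt.IsQuantumProofExtractor f (k + 1) (6 * √(Fintype.card M) * ε) := by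
  rintro q _ ⟨hstate, r, hr, rfl⟩ hk
  have : Nonempty N := hstate.nonempty.elim fun p => ⟨p.2⟩
  rw [QExt.sum_kronecker_single_eq_blockDiagonal] at hstate hk ⊢
  have htr : (∑ x, r x).trace = 1 := by
    rw [Matrix.trace_sum, ← Matrix.trace_blockDiagonal, hstate.2]
  rw [QExt.output_sub_eq_blockDiagonal]
  exact hf.traceNorm_blockDiagonal_bias_le (fun x => Matrix.nonneg_iff_posSemidef.2 (hr x)) htr hk

theorem mainTheorem9 (n m d : ℕ) (k ε : ℝ) (f : BitString d → BitString n → BitString m)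
    (hf : QExt.IsExtractor f k ε) :
    QExt.IsQuantumProofExtractor f (k + 1) (6 * √((2 : ℝ) ^ m) * ε) := by
  have hcard : (Fintype.card (BitString m) : ℝ) = 2 ^ m := by simp [BitString]
  exact hcard ▸ mainTheorem9_general hf
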